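/- Conventions. All topological spaces are separable and metrizable; maps need not be continuous unless this is said; a homotopy is always continuous. A metric space is proper if its closed balls are compact. A locally compact space $X$ is an ANR if, whenever $X$ is embedded as a closed subset of a space $Z$, some neighborhood of $X$ in $Z$ retracts onto $X$. A metric space $X$ is uniformly contractible if for each $R>0$ there is $S>R$ such that, for every $x\in X$, the inclusion of the open ball $B(x,R)$ in $B(x,S)$ is null-homotopic. It has finite macroscopic dimension if it has an open cover whose members have diameters bounded by a common constant, and such that for some integer $k$ no point lies in more than $k$ members. Two functions $f,g:X\to Y$ are boundedly close if $\sup_{x} d(f(x),g(x))<\infty$. A function $f:X\to Y$ is coarse if preimages of bounded sets are bounded and for every $R>0$ there is $S>0$ such that $d(x,x')<R$ implies $d(f(x),f(x'))<S$. A coarse inverse of $f:X\to Y$ is a coarse map $g:Y\to X$ such that $gf$ and $fg$ are boundedly close to $\operatorname{id}_X$ and $\operatorname{id}_Y$; a coarse equivalence is a coarse map that has a coarse inverse. A homotopy $H:X\times[0,1]\to Y$ is bounded if the diameters of the tracks $H(\{x\}\times[0,1])$, $x\in X$, have a common bound; it is proper if preimages of compact sets are compact. A continuous map $f:X\to Y$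 is a proper homotopy equivalence if there is a continuous $g:Y\to X$ such that $gf$ and $fg$ are homotopic to $\operatorname{id}_X$ and $\operatorname{id}_Y$ via proper homotopies. **Corollary 5.4.** Let $f':X\to Y$ be a coarse equivalence between uniformly contractible proper metric ANRs, each having finite macroscopic dimension. Then there are continuous maps $f:X\to Y$ and $g:Y\to X$ such that 1. $f$ is a coarse equivalence and is boundedly close to $f'$; 2. $g$ is a coarse inverse of $f$, and also of $f'$; 3. $gf$ and $fg$ are homotopic to $\operatorname{id}_X$ and $\operatorname{id}_Y$, respectively, by homotopies that are both bounded and proper; in particular $f$ and $g$ are proper homotopy equivalences. -/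

import Mathlib

open Set Topology

universe u v

namespace Coarse

/-- A separable metrizable locally compact space `X` is an *absolute neighborhood retract* if,
whenever it is embedded as a closed subset of a separable metrizable space `Z`, some neighborhood
of the image retracts onto the image. (A separable metrizable space has at most continuum many
points, so it is homeomorphic to a space in any prescribed universe: letting `Z` range over the
universe of `X` is no restriction.) -/
structure IsANR (X : Type u) [TopologicalSpace X] : Prop where
  metrizable : TopologicalSpace.MetrizableSpace X
  separable : TopologicalSpace.SeparableSpace X
  locallyCompact : LocallyCompactSpace X
  retract : ∀ (Z : Type u) [TopologicalSpace Z] [TopologicalSpace.MetrizableSpace Z]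
    [TopologicalSpace.SeparableSpace Z] (e : X → Z), IsClosedEmbedding e →
    ∃ U : Set Z, IsOpen U ∧ range e ⊆ U ∧
      ∃ r : U → Z, Continuous r ∧ (∀ z, r z ∈ range e) ∧ ∀ z : U, (z : Z) ∈ range e → r z = z

/-- The diameters of the members of the family are bounded above by a common real number. -/
def UniformlyBounded {X : Type u} [MetricSpace X] (𝒜 : Set (Set X)) : Prop :=
  ∃ D : ℝ, ∀ A ∈ 𝒜, ∀ x ∈ A, ∀ y ∈ A, dist x y ≤ D

/-- `X` has a uniformly bounded open cover of finite order: for some `k`, no point of `X`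
lies in more than `k` members of the cover. -/
def FiniteMacroscopicDimension (X : Type u) [MetricSpace X] : Prop :=
  ∃ 𝒰 : Set (Set X), (∀ U ∈ 𝒰, IsOpen U) ∧ ⋃₀ 𝒰 = univ ∧ UniformlyBounded 𝒰 ∧
    ∃ k : ℕ, ∀ x : X, {U ∈ 𝒰 | x ∈ U}.encard ≤ k

/-- `A` contracts in `B`: `A ⊆ B` and the inclusion of `A` in `B` is null-homotopic. -/
def ContractsIn {X : Type u} [TopologicalSpace X] (A B : Set X) : Prop :=
  ∃ h : A ⊆ B, (ContinuousMap.inclusion h).Nullhomotopic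

/-- For each `R > 0` there is `S > R` such that every open ball `B(x, R)` contracts
in `B(x, S)`. -/
def UniformlyContractible (X : Type u) [MetricSpace X] : Prop :=
  ∀ R : ℝ, 0 < R → ∃ S : ℝ, R < S ∧
    ∀ x : X, ContractsIn (Metric.ball x R) (Metric.ball x S)

variable {X : Type u} {Y : Type v} [MetricSpace X] [MetricSpace Y]

/-- Preimages of bounded sets are bounded. -/
def MetricallyProper (f : X → Y) : Prop :=
  ∀ B : Set Y, Bornology.IsBounded B → Bornology.IsBounded (f ⁻¹' B)

/-- Large-scale uniform (bornologous) functions; no continuity is required. -/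
def LargeScaleUniform (f : X → Y) : Prop :=
  ∀ R : ℝ, 0 < R → ∃ S : ℝ, 0 < S ∧ ∀ x x' : X, dist x x' < R → dist (f x) (f x') < S

/-- The distances `d(f(x), g(x))` are bounded above. -/
def BoundedlyClose {A : Type u} {B : Type v} [MetricSpace B] (f g : A → B) : Prop :=
  ∃ D : ℝ, ∀ x : A, dist (f x) (g x) ≤ D

/-- A coarse map: metrically proper and large-scale uniform, not necessarily continuous. -/
def IsCoarse (f : X → Y) : Prop :=
  MetricallyProper f ∧ LargeScaleUniform f

/-- `g` is a coarse inverse of `f`: it is coarse, and `g ∘ f` and `f ∘ g` are boundedly close to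
the identities. -/
def IsCoarseInverse (f : X → Y) (g : Y → X) : Prop :=
  IsCoarse g ∧ BoundedlyClose (g ∘ f) id ∧ BoundedlyClose (f ∘ g) id

/-- A coarse equivalence is a coarse map that has a coarse inverse. -/
def IsCoarseEquivalence (f : X → Y) : Prop :=
  IsCoarse f ∧ ∃ g : Y → X, IsCoarseInverse f g

/-- A homotopy is bounded if its tracks `H({x} × [0,1])` are uniformly bounded. -/
def IsBoundedHomotopy {f g : C(X, Y)} (H : f.Homotopy g) : Prop :=
  UniformlyBounded (range fun x : X => range fun t : unitInterval => H (t, x))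

/-- A continuous map with a homotopy inverse for which both homotopies to the identities can be
chosen to be proper maps. -/
def IsProperHomotopyEquivalence {A : Type u} {B : Type v} [TopologicalSpace A]
    [TopologicalSpace B] (f : C(A, B)) : Prop :=
  ∃ g : C(B, A),
    (∃ H : (g.comp f).Homotopy (ContinuousMap.id A), IsProperMap H) ∧
    (∃ H : (f.comp g).Homotopy (ContinuousMap.id B), IsProperMap H)

end Coarse

/-! The maps and the homotopies all come from one relative approximation theorem,
`exists_continuous_extension_boundedlyClose`. With nothing prescribed, it replaces `f'` and a coarse
inverse of it by continuous maps at bounded distance. Applied to the projection of [0,1] × X onto X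
with both ends prescribed, it gives a homotopy; closeness to the projection makes it bounded and
proper.

The approximation resembles obstruction theory, with multiplicity in a closed cover replacing
skeleta: the map is built on the points lying in at least j members, for descending j. Uniform
contractibility bounds the error added at each level, independently of the piece, and finite order
leaves finitely many levels. -/

/-! ### Extending maps into a proper ANR -/

theorem isClosedEmbedding_dist_denseSeq (Y : Type*) [MetricSpace Y] [ProperSpace Y] [Nonempty Y] :
    IsClosedEmbedding (fun (y : Y) (n : ℕ) => dist y (TopologicalSpace.denseSeq Y n)) := by
  have hcont : Continuous fun (y : Y) (n : ℕ) => dist y (TopologicalSpace.denseSeq Y n) := by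
    fun_prop
  refine .of_continuous_injective_isClosedMap hcont (fun y z hyz => ?_) ?_
  · have hd : ∀ n, dist y (TopologicalSpace.denseSeq Y n) =
        dist z (TopologicalSpace.denseSeq Y n) := fun n => congrFun hyz n
    have key : (fun w => dist y w) = fun w => dist z w := by
      refine (TopologicalSpace.denseRange_denseSeq Y).equalizer (by fun_prop) (by fun_prop) ?_
      funext n
      exact hd n
    have := congrFun key z
    simpa using this
  -- Coordinate 0 alone is proper, because closed balls are compact.
  · refine IsProperMap.isClosedMap (isProperMap_of_comp_of_t2 hcont (continuous_apply 0) ?_)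
    refine isProperMap_iff_isCompact_preimage.2 ⟨by fun_prop, fun K hK => ?_⟩
    obtain ⟨r, hr⟩ := hK.bddAbove
    refine (isCompact_closedBall (TopologicalSpace.denseSeq Y 0) r).of_isClosed_subset
      (hK.isClosed.preimage (by fun_prop)) fun y hy => ?_
    exact hr hy

/-- A continuous map from a closed subset of a normal space to a proper metric ANR extends to a
neighborhood of that subset. -/
theorem Coarse.IsANR.exists_extension_nhds {Y : Type v} [MetricSpace Y] [ProperSpace Y]
    (hY : Coarse.IsANR Y) {T : Type*} [TopologicalSpace T] [NormalSpace T] {C : Set T}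
    (hC : IsClosed C) {h : T → Y} (hh : ContinuousOn h C) :
    ∃ V, IsOpen V ∧ C ⊆ V ∧ ∃ G : T → Y, ContinuousOn G V ∧ EqOn G h C := by
  classical
  rcases isEmpty_or_nonempty Y with hY0 | hY0
  · exact ⟨univ, isOpen_univ, subset_univ _, h, fun t => (hY0.false (h t)).elim, eqOn_refl _ _⟩
  have he : IsClosedEmbedding (fun y : Y => (ULift.up fun n =>
      dist y (TopologicalSpace.denseSeq Y n) : ULift.{v} (ℕ → ℝ))) :=
    Homeomorph.ulift.symm.isClosedEmbedding.comp (isClosedEmbedding_dist_denseSeq Y)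
  set e : Y → ULift.{v} (ℕ → ℝ) := fun y => ULift.up fun n =>
      dist y (TopologicalSpace.denseSeq Y n)
  have : TopologicalSpace.MetrizableSpace (ULift.{v} (ℕ → ℝ)) :=
    Homeomorph.ulift.isEmbedding.metrizableSpace
  have : TopologicalSpace.SeparableSpace (ULift.{v} (ℕ → ℝ)) :=
    Homeomorph.ulift.symm.surjective.denseRange.separableSpace Homeomorph.ulift.symm.continuous
  obtain ⟨U, hU, heU, r, hr, hrange, hfix⟩ := hY.retract _ e he
  -- Tietze extends into the ambient product of lines; the retraction then brings values near `C`
  -- back to `Y`.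
  obtain ⟨φ, hφ⟩ := ContinuousMap.exists_restrict_eq hC
    (⟨fun c : C => (e (h c)).down, by
      exact (Homeomorph.ulift.continuous.comp he.continuous).comp
        (continuousOn_iff_continuous_domRestrict.1 hh)⟩ : C(C, ℕ → ℝ))
  have hφC : ∀ c ∈ C, ULift.up (φ c) = e (h c) := fun c hc =>
    congrArg ULift.up (DFunLike.congr_fun hφ ⟨c, hc⟩)
  have hφ' : Continuous fun t => (ULift.up (φ t) : ULift.{v} (ℕ → ℝ)) :=
    Homeomorph.ulift.symm.continuous.comp φ.continuous
  choose s hs using hrange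
  have hscont : Continuous s := he.isEmbedding.continuous_iff.2 (by
    have : e ∘ s = r := funext hs
    rwa [this])
  refine ⟨(fun t => ULift.up (φ t)) ⁻¹' U, hU.preimage hφ', fun c hc => heU ⟨h c, (hφC c hc).symm⟩,
    fun t => if ht : ULift.up (φ t) ∈ U then s ⟨_, ht⟩ else h t, ?_, fun c hc => ?_⟩
  · rw [continuousOn_iff_continuous_domRestrict]
    have : Continuous fun t : ((fun t => ULift.up (φ t)) ⁻¹' U : Set T) =>
        s ⟨ULift.up (φ t), t.2⟩ :=
      hscont.comp ((hφ'.comp continuous_subtype_val).subtype_mk _)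
    refine this.congr fun t => ?_
    have ht : ULift.up (φ t) ∈ U := t.2
    simp only [domRestrict_apply, dif_pos ht]
  · have hcU : ULift.up (φ c) ∈ U := heU ⟨h c, (hφC c hc).symm⟩
    have hmem : ULift.up (φ c) ∈ range e := ⟨h c, (hφC c hc).symm⟩
    simp only [dif_pos hcU]
    apply he.injective
    exact (hs _).trans ((hfix ⟨_, hcU⟩ hmem).trans (hφC c hc))

/-- A continuous map from a closed subset of `W` to a ball which contracts in a larger ball of a
proper metric ANR extends to a map from `W` to the larger ball. -/
theorem Coarse.IsANR.exists_extension_of_contractsIn {Y : Type v} [MetricSpace Y] [ProperSpace Y]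
    (hY : Coarse.IsANR Y) {W : Type*} [TopologicalSpace W] [TopologicalSpace.MetrizableSpace W]
    {A B : Set Y} (hB : IsOpen B) (hAB : Coarse.ContractsIn A B) {C : Set W}
    (hC : IsClosed C) {h : W → Y} (hh : ContinuousOn h C) (hA : MapsTo h C A) :
    ∃ H : W → Y, Continuous H ∧ EqOn H h C ∧ ∀ w, H w ∈ B := by
  classical
  obtain ⟨hsub, ⟨y, hy⟩, ⟨K⟩⟩ := hAB
  -- The null-homotopy over `C`, together with the constant `y` on the end t = 1; this is extended
  -- to a neighborhood.
  let k : W × unitInterval → Y := fun p =>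
    if hp : p.1 ∈ C then (K (p.2, ⟨h p.1, hA hp⟩) : Y) else y
  have hkB : ∀ p, k p ∈ B := fun p => by
    by_cases hp : p.1 ∈ C
    · simp only [k, dif_pos hp, Subtype.coe_prop]
    · simpa only [k, dif_neg hp] using hy
  have hk0 : ∀ w ∈ C, k (w, 0) = h w := fun w hw => by
    simp only [k, dif_pos hw, ContinuousMap.Homotopy.apply_zero]
    rfl
  have hk1 : ∀ w, k (w, 1) = y := fun w => by
    by_cases hw : w ∈ C <;> simp [k, hw]
  have hclosed1 : IsClosed (C ×ˢ univ : Set (W × unitInterval)) := hC.prod isClosed_univ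
  have hclosed2 : IsClosed (univ ×ˢ {1} : Set (W × unitInterval)) :=
    isClosed_univ.prod isClosed_singleton
  have hk : ContinuousOn k (C ×ˢ univ ∪ univ ×ˢ {1}) := by
    refine ContinuousOn.union_of_isClosed ?_ ?_ hclosed1 hclosed2
    · rw [continuousOn_iff_continuous_domRestrict]
      have hres : Continuous (C.domRestrict h) := continuousOn_iff_continuous_domRestrict.1 hh
      have : Continuous fun p : (C ×ˢ univ : Set (W × unitInterval)) =>
          (K (p.1.2, ⟨C.domRestrict h ⟨p.1.1, p.2.1⟩, hA p.2.1⟩) : Y) := by fun_prop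
      refine this.congr fun p => ?_
      have hp : p.1.1 ∈ C := p.2.1
      simp only [k, domRestrict_apply, dif_pos hp]
    · refine (continuousOn_const (c := y)).congr ?_
      rintro ⟨w, t⟩ ⟨-, rfl⟩
      exact hk1 w
  obtain ⟨V, hV, hCV, G, hG, hGk⟩ := hY.exists_extension_nhds (hclosed1.union hclosed2) hk
  have hO : IsOpen (V ∩ G ⁻¹' B) := hG.isOpen_inter_preimage hV hB
  have hCO : C ×ˢ univ ∪ univ ×ˢ {1} ⊆ V ∩ G ⁻¹' B := fun p hp =>
    ⟨hCV hp, by rw [mem_preimage, hGk hp]; exact hkB p⟩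
  have hD : IsClosed (Prod.fst '' (V ∩ G ⁻¹' B)ᶜ) := isClosedMap_fst_of_compactSpace _
    hO.isClosed_compl
  -- The graph of a Urysohn function `u` stays in the good open set: over a fibre that leaves it,
  -- `u` = 1, and the end t = 1 is always good.
  let _ := TopologicalSpace.metrizableSpaceMetric W
  obtain ⟨u, hu0, hu1, hu⟩ := exists_continuous_zero_one_of_isClosed hC hD (by
    rw [Set.disjoint_left]
    rintro _ hw ⟨p, hp, rfl⟩
    exact hp (hCO (Or.inl ⟨hw, mem_univ _⟩)))
  have hmem : ∀ w, ((w, ⟨u w, hu w⟩) : W × unitInterval) ∈ V ∩ G ⁻¹' B := fun w => by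
    by_contra hw
    have h1 : u w = 1 := hu1 ⟨_, hw, rfl⟩
    exact hw (hCO (Or.inr ⟨mem_univ _, Subtype.ext h1⟩))
  refine ⟨fun w => G (w, ⟨u w, hu w⟩), ?_, fun w hw => ?_, fun w => (hmem w).2⟩
  · exact hG.comp_continuous (by fun_prop) fun w => (hmem w).1
  · have h0 : (⟨u w, hu w⟩ : unitInterval) = 0 := Subtype.ext (hu0 hw)
    simp only [h0]
    rw [hGk (Or.inl ⟨hw, mem_univ _⟩), hk0 w hw]

/-! ### Closed covers of finite order -/

/-- A finite-order uniformly bounded open cover may be replaced by a closed locally finite one. -/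
theorem Coarse.FiniteMacroscopicDimension.exists_closed_cover {X : Type u} [MetricSpace X]
    (hX : Coarse.FiniteMacroscopicDimension X) :
    ∃ (ι : Type u) (F : ι → Set X) (D : ℝ) (k : ℕ), (∀ i, IsClosed (F i)) ∧ LocallyFinite F ∧
      (∀ x, ∃ i, x ∈ F i) ∧ (∀ x, {i | x ∈ F i}.encard ≤ k) ∧
      ∀ i, ∀ a ∈ F i, ∀ b ∈ F i, dist a b ≤ D := by
  obtain ⟨𝒰, hopen, hcov, ⟨D, hD⟩, k, hk⟩ := hX
  -- The refinement and its shrinking keep the index set `𝒰`, so multiplicities do not grow.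
  obtain ⟨v, hvo, hvc, hvl, hvu⟩ := precise_refinement (fun U : 𝒰 => (U : Set X))
    (fun U => hopen U U.2) (by rw [← sUnion_eq_iUnion, hcov])
  obtain ⟨F, hFc, hFcl, hFv⟩ := exists_iUnion_eq_closed_subset hvo
    (fun x => hvl.point_finite x) hvc
  refine ⟨𝒰, F, D, k, hFcl, hvl.subset hFv, fun x => mem_iUnion.1 (hFc ▸ mem_univ x), fun x => ?_,
    fun i a ha b hb => hD i i.2 a (hvu i (hFv i ha)) b (hvu i (hFv i hb))⟩
  refine le_trans ?_ (hk x)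
  rw [← Subtype.val_injective.encard_image]
  refine encard_le_encard ?_
  rintro _ ⟨i, hi, rfl⟩
  exact ⟨i.2, hvu i (hFv i hi)⟩

/-! ### Controlled approximation by descending multiplicity -/

namespace Coarse

variable {Y : Type v} [MetricSpace Y] [ProperSpace Y] {W : Type*} [TopologicalSpace W]
  [TopologicalSpace.MetrizableSpace W]

/-- A controlled map on a closed set `A` extends, with worse control, over a locally finite family
of closed sets of bounded size which are pairwise disjoint off `A`. -/
theorem exists_extension_union_iUnion (hY : IsANR Y) (hYc : UniformlyContractible Y)
    {A : Set W} (hA : IsClosed A) {κ : Type*} {P : κ → Set W} (hP : ∀ s, IsClosed (P s))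
    (hPl : LocallyFinite P) (hPA : ∀ s t, s ≠ t → P s ∩ P t ⊆ A) {f' : W → Y} {D : ℝ}
    (hD : ∀ s, ∀ a ∈ P s, ∀ b ∈ P s, dist (f' a) (f' b) ≤ D) {h : W → Y}
    (hh : ContinuousOn h A) {E : ℝ} (hE : ∀ a ∈ A, dist (h a) (f' a) ≤ E) :
    ∃ (h' : W → Y) (E' : ℝ), ContinuousOn h' (A ∪ ⋃ s, P s) ∧ EqOn h' h A ∧
      ∀ a ∈ A ∪ ⋃ s, P s, dist (h' a) (f' a) ≤ E' := by
  classical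
  -- This radius puts `h (P s ∩ A)` in a ball about `f' w₀`, for any `w₀` in `P s`; `S` serves all
  -- `s` at once.
  obtain ⟨S, -, hS⟩ := hYc (|E| + |D| + 1) (by positivity)
  have key : ∀ s, ∃ H : W → Y, ContinuousOn H (P s) ∧ EqOn H h (P s ∩ A) ∧
      ∀ w ∈ P s, dist (H w) (f' w) ≤ S + D := fun s => by
    rcases (P s).eq_empty_or_nonempty with hs | ⟨w₀, hw₀⟩
    · exact ⟨h, by simp [hs], eqOn_refl _ _, by simp [hs]⟩
    obtain ⟨H, hH, hHh, hHS⟩ := hY.exists_extension_of_contractsIn Metric.isOpen_ball (hS (f' w₀))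
      ((hP s).inter hA) (hh.mono inter_subset_right) fun w hw => by
        have h1 := hE w hw.2
        have h2 := hD s w hw.1 w₀ hw₀
        have h3 := dist_triangle (h w) (f' w) (f' w₀)
        rw [Metric.mem_ball]
        linarith [le_abs_self E, le_abs_self D]
    refine ⟨H, hH.continuousOn, hHh, fun w hw => ?_⟩
    have h1 := Metric.mem_ball.1 (hHS w)
    have h2 := hD s w₀ hw₀ w hw
    linarith [dist_triangle (H w) (f' w₀) (f' w)]
  choose H hH hHh hHS using key
  -- Off `A` a point lies in at most one `P s`, so the choice is forced.
  let h' : W → Y := fun w => if w ∈ A then h w else if hw : ∃ s, w ∈ P s then H hw.choose w else h w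
  have hA' : EqOn h' h A := fun w hw => if_pos hw
  have hP' : ∀ s, EqOn h' (H s) (P s) := fun s w hw => by
    by_cases hwA : w ∈ A
    · rw [hA' hwA, hHh s ⟨hw, hwA⟩]
    · have hex : ∃ s, w ∈ P s := ⟨s, hw⟩
      have hs : hex.choose = s := by
        by_contra hne
        exact hwA (hPA _ _ hne ⟨hex.choose_spec, hw⟩)
      simp only [h', if_neg hwA, dif_pos hex, hs]
  refine ⟨h', max E (S + D), ?_, hA', ?_⟩
  · exact (hh.congr hA').union_of_isClosed
      (hPl.continuousOn_iUnion hP fun s => (hH s).congr (hP' s)) hA (hPl.isClosed_iUnion hP)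
  · rintro a (ha | ha)
    · rw [hA' ha]
      exact (hE a ha).trans (le_max_left _ _)
    · obtain ⟨s, hs⟩ := mem_iUnion.1 ha
      rw [hP' s hs]
      exact (hHS s a hs).trans (le_max_right _ _)

/-- Relative approximation by continuous maps: a function `f'` into a uniformly contractible proper
metric ANR which has bounded oscillation on the members of a closed locally finite cover of finite
order is boundedly close to a continuous map, with prescribed values on a closed set. -/
theorem exists_continuous_extension_boundedlyClose (hY : IsANR Y) (hYc : UniformlyContractible Y)
    {ι : Type*} {F : ι → Set W} (hF : ∀ i, IsClosed (F i)) (hFl : LocallyFinite F)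
    (hFc : ∀ w, ∃ i, w ∈ F i) {k : ℕ} (hk : ∀ w, {i | w ∈ F i}.encard ≤ k) {f' : W → Y} {D : ℝ}
    (hD : ∀ i, ∀ a ∈ F i, ∀ b ∈ F i, dist (f' a) (f' b) ≤ D) {C : Set W} (hC : IsClosed C)
    {h : W → Y} (hh : ContinuousOn h C) {E : ℝ} (hE : ∀ c ∈ C, dist (h c) (f' c) ≤ E) :
    ∃ f : W → Y, Continuous f ∧ EqOn f h C ∧ ∃ E' : ℝ, ∀ w, dist (f w) (f' w) ≤ E' := by
  classical
  -- The union of `P j` consists of the points in at least `j` members. Two distinct pieces of level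
  -- `j` meet only in level `j + 1`.
  let P : (j : ℕ) → {σ : Finset ι // σ.card = j} → Set W := fun j σ => ⋂ i ∈ σ.1, F i
  have hPmem : ∀ {j} {σ : {σ : Finset ι // σ.card = j}} {w}, w ∈ P j σ ↔ ∀ i ∈ σ.1, w ∈ F i :=
    fun {j σ w} => by simp [P]
  have hP : ∀ j σ, IsClosed (P j σ) := fun j σ => isClosed_biInter fun i _ => hF i
  have hPl : ∀ j, 1 ≤ j → LocallyFinite (P j) := fun j hj w => by
    obtain ⟨t, ht, hfin⟩ := hFl w
    refine ⟨t, ht, (hfin.toFinset.powerset.finite_toSet.preimage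
      Subtype.val_injective.injOn).subset ?_⟩
    rintro σ ⟨x, hx, hxt⟩
    simp only [mem_preimage, Finset.mem_coe, Finset.mem_powerset]
    intro i hi
    exact hfin.mem_toFinset.2 ⟨x, hPmem.1 hx i hi, hxt⟩
  have hPsub : ∀ j, ⋃ σ, P (j + 1) σ ⊆ ⋃ σ, P j σ := fun j w hw => by
    obtain ⟨σ, hσ⟩ := mem_iUnion.1 hw
    obtain ⟨τ, hτ, hc⟩ := Finset.exists_subset_card_eq (show j ≤ σ.1.card by rw [σ.2]; omega)
    exact mem_iUnion.2 ⟨⟨τ, hc⟩, hPmem.2 fun i hi => hPmem.1 hσ i (hτ hi)⟩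
  have hPinter : ∀ j (σ τ), σ ≠ τ → P j σ ∩ P j τ ⊆ ⋃ σ, P (j + 1) σ := fun j σ τ hne w hw => by
    have hcard : j + 1 ≤ (σ.1 ∪ τ.1).card := by
      by_contra hlt
      have h1 := Finset.eq_of_subset_of_card_le (Finset.subset_union_left (s₁ := σ.1) (s₂ := τ.1))
        (by rw [σ.2]; omega)
      have h2 := Finset.eq_of_subset_of_card_le (Finset.subset_union_right (s₁ := σ.1) (s₂ := τ.1))
        (by rw [τ.2]; omega)
      exact hne (Subtype.ext (h1.trans h2.symm))
    obtain ⟨ρ, hρ, hc⟩ := Finset.exists_subset_card_eq hcard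
    refine mem_iUnion.2 ⟨⟨ρ, hc⟩, hPmem.2 fun i hi => ?_⟩
    rcases Finset.mem_union.1 (hρ hi) with hi | hi
    exacts [hPmem.1 hw.1 i hi, hPmem.1 hw.2 i hi]
  -- Level `k + 1` is empty and level 1 is everything; `j ≥ 1` puts each piece inside some `F i`,
  -- where `f'` oscillates by at most `D`.
  have main : ∀ n j, 1 ≤ j → j + n = k + 1 → ∃ (h' : W → Y) (E' : ℝ),
      ContinuousOn h' (C ∪ ⋃ σ, P j σ) ∧ EqOn h' h C ∧
        ∀ a ∈ C ∪ ⋃ σ, P j σ, dist (h' a) (f' a) ≤ E' := by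
    intro n
    induction n with
    | zero =>
      rintro j - rfl
      have hempty : ⋃ σ, P (k + 1) σ = ∅ := by
        refine iUnion_eq_empty.2 fun σ => eq_empty_of_forall_notMem fun w hw => ?_
        have h1 : (σ.1 : Set ι).encard ≤ k :=
          (encard_le_encard fun i hi => hPmem.1 hw i hi).trans (hk w)
        rw [encard_coe_eq_coe_finsetCard, σ.2] at h1
        have h2 : k + 1 ≤ k := by exact_mod_cast h1
        omega
      rw [hempty, union_empty]
      exact ⟨h, E, hh, eqOn_refl _ _, hE⟩
    | succ n ih =>
      intro j hj hjn
      obtain ⟨h₁, E₁, hh₁, heq, hE₁⟩ := ih (j + 1) (by omega) (by omega)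
      obtain ⟨h₂, E₂, hh₂, heq₂, hE₂⟩ := exists_extension_union_iUnion hY hYc
        (hC.union ((hPl (j + 1) (by omega)).isClosed_iUnion (hP _))) (hP j) (hPl j hj)
        (fun σ τ hne => (hPinter j σ τ hne).trans subset_union_right) (f' := f') (D := D)
        (fun σ a ha b hb => by
          obtain ⟨i, hi⟩ := Finset.card_pos.1 (show 0 < σ.1.card by rw [σ.2]; omega)
          exact hD i a (hPmem.1 ha i hi) b (hPmem.1 hb i hi)) hh₁ hE₁
      rw [union_assoc, union_eq_self_of_subset_left (hPsub j)] at hh₂ hE₂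
      exact ⟨h₂, E₂, hh₂, (heq₂.mono subset_union_left).trans heq, hE₂⟩
  obtain ⟨f, E', hf, hfh, hE'⟩ := main k 1 le_rfl (by omega)
  have huniv : C ∪ ⋃ σ, P 1 σ = univ := by
    refine eq_univ_of_forall fun w => Or.inr ?_
    obtain ⟨i, hi⟩ := hFc w
    exact mem_iUnion.2 ⟨⟨{i}, Finset.card_singleton i⟩, hPmem.2 (by simpa using hi)⟩
  rw [huniv] at hf hE'
  exact ⟨f, continuousOn_univ.1 hf, hfh, E', fun w => hE' w (mem_univ w)⟩

end Coarse

/-! ### Bounded closeness, continuous representatives and homotopies -/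

namespace Coarse

section

variable {X : Type u} {Y : Type v} [MetricSpace X] [MetricSpace Y]

theorem BoundedlyClose.symm {A : Type u} {f g : A → Y} (h : BoundedlyClose f g) :
    BoundedlyClose g f := by
  obtain ⟨D, hD⟩ := h
  exact ⟨D, fun x => by rw [dist_comm]; exact hD x⟩

theorem BoundedlyClose.trans {A : Type u} {f g h : A → Y} (hfg : BoundedlyClose f g)
    (hgh : BoundedlyClose g h) : BoundedlyClose f h := by
  obtain ⟨D, hD⟩ := hfg
  obtain ⟨E, hE⟩ := hgh
  exact ⟨D + E, fun x => (dist_triangle _ (g x) _).trans (add_le_add (hD x) (hE x))⟩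

theorem BoundedlyClose.comp_right {A : Type*} {B : Type*} {f g : A → Y}
    (h : BoundedlyClose f g) (k : B → A) : BoundedlyClose (f ∘ k) (g ∘ k) := by
  obtain ⟨D, hD⟩ := h
  exact ⟨D, fun x => hD (k x)⟩

theorem LargeScaleUniform.comp_boundedlyClose {A : Type*} {k : X → Y} (hk : LargeScaleUniform k)
    {f g : A → X} (h : BoundedlyClose f g) : BoundedlyClose (k ∘ f) (k ∘ g) := by
  obtain ⟨D, hD⟩ := h
  obtain ⟨S, -, hS⟩ := hk (|D| + 1) (by positivity)
  exact ⟨S, fun x => (hS _ _ (by linarith [hD x, le_abs_self D])).le⟩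

theorem IsCoarse.of_boundedlyClose {f g : X → Y} (hf : IsCoarse f) (h : BoundedlyClose f g) :
    IsCoarse g := by
  obtain ⟨D, hD⟩ := h
  refine ⟨fun B hB => ?_, fun R hR => ?_⟩
  · refine (hf.1 _ (hB.cthickening (δ := D))).subset fun x hx => ?_
    exact Metric.mem_cthickening_of_dist_le _ _ _ _ hx (hD x)
  · obtain ⟨S, hS, hRS⟩ := hf.2 R hR
    refine ⟨S + 2 * |D|, by positivity, fun x x' hxx' => ?_⟩
    have h1 := hRS x x' hxx'
    have h2 := dist_triangle4 (g x) (f x) (f x') (g x')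
    have h3 := hD x
    rw [dist_comm] at h3
    linarith [hD x', le_abs_self D]

theorem IsCoarseInverse.of_boundedlyClose {f f₁ : X → Y} {g g₁ : Y → X}
    (h : IsCoarseInverse f g) (hf₁ : IsCoarse f₁) (hf : BoundedlyClose f f₁)
    (hg : BoundedlyClose g g₁) : IsCoarseInverse f₁ g₁ := by
  obtain ⟨hgc, hgf, hfg⟩ := h
  refine ⟨hgc.of_boundedlyClose hg, ?_, ?_⟩
  · exact (hg.comp_right f₁).symm.trans ((hgc.2.comp_boundedlyClose hf.symm).trans hgf)
  · exact (hf₁.2.comp_boundedlyClose hg.symm).trans ((hf.comp_right g).symm.trans hfg)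

/-- Large-scale uniform functions to a uniformly contractible proper metric ANR are boundedly close
to continuous maps. -/
theorem LargeScaleUniform.exists_continuous_boundedlyClose [ProperSpace Y]
    (hXd : FiniteMacroscopicDimension X) (hY : IsANR Y) (hYc : UniformlyContractible Y)
    {f' : X → Y} (hf' : LargeScaleUniform f') : ∃ f : C(X, Y), BoundedlyClose f' f := by
  obtain ⟨ι, F, D, k, hF, hFl, hFc, hk, hD⟩ := hXd.exists_closed_cover
  obtain ⟨S, -, hS⟩ := hf' (|D| + 1) (by positivity)
  obtain ⟨f, hf, -, E, hE⟩ := exists_continuous_extension_boundedlyClose hY hYc hF hFl hFc hk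
    (f' := f') (D := S) (fun i a ha b hb =>
      (hS a b (by linarith [hD i a ha b hb, le_abs_self D])).le)
    isClosed_empty (continuousOn_empty f') (E := 0) (by simp)
  exact ⟨⟨f, hf⟩, BoundedlyClose.symm ⟨E, hE⟩⟩

end

/-- A continuous self-map boundedly close to the identity is homotopic to it by a bounded proper
homotopy. -/
theorem exists_homotopy_id {X : Type u} [MetricSpace X] [ProperSpace X] (hX : IsANR X)
    (hXc : UniformlyContractible X) (hXd : FiniteMacroscopicDimension X) {p : C(X, X)}
    (hp : BoundedlyClose p id) :
    ∃ H : p.Homotopy (ContinuousMap.id X), IsBoundedHomotopy H ∧ IsProperMap H := by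
  classical
  obtain ⟨ι, F, D, k, hF, hFl, hFc, hk, hD⟩ := hXd.exists_closed_cover
  obtain ⟨E, hE⟩ := hp
  let h : unitInterval × X → X := fun w => if w.1 = 0 then p w.2 else w.2
  have hcl : ∀ t : unitInterval, IsClosed ({t} ×ˢ univ : Set (unitInterval × X)) := fun t =>
    isClosed_singleton.prod isClosed_univ
  have hh : ContinuousOn h ({0} ×ˢ univ ∪ {1} ×ˢ univ) := by
    refine ContinuousOn.union_of_isClosed ?_ ?_ (hcl 0) (hcl 1)
    · refine (show Continuous fun w : unitInterval × X => p w.2 by fun_prop).continuousOn.congr ?_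
      rintro ⟨t, x⟩ ⟨rfl, -⟩
      simp [h]
    · refine continuous_snd.continuousOn.congr ?_
      rintro ⟨t, x⟩ ⟨rfl, -⟩
      simp [h]
  obtain ⟨G, hG, hGh, E', hE'⟩ := exists_continuous_extension_boundedlyClose hX hXc
    (F := fun i => (Prod.snd ⁻¹' F i : Set (unitInterval × X)))
    (fun i => (hF i).preimage continuous_snd) (hFl.preimage_continuous continuous_snd)
    (fun w => hFc w.2) (fun w => hk w.2) (f' := Prod.snd)
    -- The bound must be at least 0 for the identity end, even if `X` is empty and `E` negative.
    (fun i a ha b hb => hD i a.2 ha b.2 hb) ((hcl 0).union (hcl 1)) hh (E := max E 0)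
    (fun c _ => by
      by_cases hc : c.1 = 0
      · simpa [h, hc] using Or.inl (hE c.2)
      · simp [h, hc])
  refine ⟨⟨⟨G, hG⟩, fun x => ?_, fun x => ?_⟩, ⟨E' + E', ?_⟩, ?_⟩
  · simpa [h] using hGh (x := (0, x)) (by simp)
  · simpa [h] using hGh (x := (1, x)) (by simp)
  · rintro _ ⟨x, rfl⟩ _ ⟨t, rfl⟩ _ ⟨s, rfl⟩
    exact (dist_triangle_right _ _ x).trans (add_le_add (hE' (t, x)) (hE' (s, x)))
  -- Tracks stay within `E'` of their base point, so the preimage of `K` lies over a closed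
  -- thickening of `K`, compact in a proper space.
  · refine isProperMap_iff_isCompact_preimage.2 ⟨hG, fun K hK => ?_⟩
    have hK' : IsCompact (Metric.cthickening E' K) := hK.cthickening
    refine (isCompact_univ.prod hK').of_isClosed_subset (hK.isClosed.preimage hG)
      fun w hw => ⟨mem_univ _, ?_⟩
    refine Metric.mem_cthickening_of_dist_le _ (G w) _ _ hw ?_
    rw [dist_comm]
    exact hE' w

end Coarse

theorem corollary5p4 {X : Type u} {Y : Type v} [MetricSpace X] [MetricSpace Y]
    [ProperSpace X] [ProperSpace Y]
    (hX : Coarse.IsANR X) (hY : Coarse.IsANR Y)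
    (hXc : Coarse.UniformlyContractible X) (hYc : Coarse.UniformlyContractible Y)
    (hXd : Coarse.FiniteMacroscopicDimension X) (hYd : Coarse.FiniteMacroscopicDimension Y)
    (f' : X → Y) (hf' : Coarse.IsCoarseEquivalence f') :
    ∃ f : C(X, Y), Coarse.BoundedlyClose f' f ∧ Coarse.IsCoarseEquivalence f ∧
      ∃ g : C(Y, X), Coarse.IsCoarseInverse f g ∧ Coarse.IsCoarseInverse f' g ∧
        (∃ H : (g.comp f).Homotopy (ContinuousMap.id X),
          Coarse.IsBoundedHomotopy H ∧ IsProperMap H) ∧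
        (∃ H : (f.comp g).Homotopy (ContinuousMap.id Y),
          Coarse.IsBoundedHomotopy H ∧ IsProperMap H) ∧
        Coarse.IsProperHomotopyEquivalence f ∧ Coarse.IsProperHomotopyEquivalence g := by
  obtain ⟨hfc, g', hg'⟩ := hf'
  obtain ⟨f, hf⟩ := hfc.2.exists_continuous_boundedlyClose hXd hY hYc
  obtain ⟨g, hg⟩ := hg'.1.2.exists_continuous_boundedlyClose hYd hX hXc
  have hf₁ : Coarse.IsCoarse f := hfc.of_boundedlyClose hf
  have hfg : Coarse.IsCoarseInverse f g := hg'.of_boundedlyClose hf₁ hf hg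
  have hf'g : Coarse.IsCoarseInverse f' g :=
    hg'.of_boundedlyClose hfc ⟨0, fun x => (dist_self _).le⟩ hg
  obtain ⟨H, hHb, hHp⟩ := Coarse.exists_homotopy_id hX hXc hXd (p := g.comp f) hfg.2.1
  obtain ⟨K, hKb, hKp⟩ := Coarse.exists_homotopy_id hY hYc hYd (p := f.comp g) hfg.2.2
  exact ⟨f, hf, ⟨hf₁, g, hfg⟩, g, hfg, hf'g, ⟨H, hHb, hHp⟩, ⟨K, hKb, hKp⟩,
    ⟨g, ⟨H, hHp⟩, ⟨K, hKp⟩⟩, ⟨f, ⟨K, hKp⟩, ⟨H, hHp⟩⟩⟩
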